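/- Notation. For a group $G$ and $n\ge 2$ let $\mathcal K(G,n)$ be the kernel of the homomorphism $G^n\to G^{\mathrm{ab}}$, $(g_1,\dots,g_n)\mapsto\overline{g_1\cdots g_n}$. Choose a presentation $G\cong F/N$ with $F$ a free group and put $\widetilde{\mathcal K}(G,n):=\mathcal K(F,n)/\langle\!\langle\mathcal K(N,n)\rangle\!\rangle$, where $\langle\!\langle\mathcal K(N,n)\rangle\!\rangle$ is the normal closure of $\mathcal K(N,n)$ in $F^n$. The projection $F\to G$ induces $\widetilde{\mathcal K}(G,n)\to\mathcal K(G,n)$. If $G$ is Abelian, forgetting the last coordinate identifies $\mathcal K(G,n)$ with $G^{n-1}$. Hopf's isomorphism $H_2(G,\mathbb Z)\cong(N\cap[F,F])/[F,N]$ followed by $x\mapsto(x,1,\dots,1)$ is a map $H_2(G,\mathbb Z)\to\widetilde{\mathcal K}(G,n)$. $\Phi$ denotes the Frattini subgroup (the intersection of all maximal subgroups). **Proposition.** Let $p$ be a prime, $G$ an Abelian $p$-group and $n\ge 3$. Then, for every choice of the presentation, these maps form a short exact sequence $$0\to H_2(G,\mathbb Z)\to\widetilde{\mathcal K}(G,n)\to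 G^{n-1}\to 1,\qquad(*)$$ and the following hold. 1. If $G$ is finite and not cyclic, then $\widetilde{\mathcal K}(G,n)$ is nilpotent of class exactly $2$. 2. The commutator subgroup of $\widetilde{\mathcal K}(G,n)$ is equal to $H_2(G,\mathbb Z)$, embedded via $(*)$. 3. The Frattini subgroup $\Phi(\widetilde{\mathcal K}(G,n))$ is an extension of $H_2(G,\mathbb Z)$ by $\Phi(G)^{n-1}$: the sequence $(*)$ restricts to a short exact sequence $$0\to H_2(G,\mathbb Z)\to\Phi(\widetilde{\mathcal K}(G,n))\to\Phi(G)^{n-1}\to 1.$$ -/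

import Mathlib

universe u v

/-- The homomorphism `ψ : Gⁿ → Gᵃᵇ`, `(g₁, …, gₙ) ↦` the class of `g₁ ⋯ gₙ`. -/
def prodAb (G : Type u) [Group G] (n : ℕ) : (Fin n → G) →* Abelianization G where
  toFun g := Abelianization.of (List.ofFn g).prod
  map_one' := by rw [map_list_prod, List.map_ofFn, List.prod_ofFn]; simp
  map_mul' g h := by simp [map_list_prod, List.map_ofFn, List.prod_ofFn, Finset.prod_mul_distrib]

/-- `𝒦(G, n)`, the kernel of `ψ : Gⁿ → Gᵃᵇ`. -/
def calK (G : Type u) [Group G] (n : ℕ) : Subgroup (Fin n → G) :=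
  (prodAb G n).ker

theorem mem_calK {G : Type u} [Group G] {n : ℕ} {x : Fin n → G} :
    x ∈ calK G n ↔ Abelianization.of (List.ofFn x).prod = 1 := Iff.rfl

/-- A homomorphism applied coordinatewise sends `𝒦(G, n)` to `𝒦(H, n)`. -/
theorem comp_mem_calK {G : Type u} {H : Type v} [Group G] [Group H] (f : G →* H) {n : ℕ}
    {x : Fin n → G} (hx : x ∈ calK G n) : (fun i => f (x i)) ∈ calK H n := by
  rw [mem_calK] at hx ⊢
  have h : (List.ofFn fun i => f (x i)).prod = f (List.ofFn x).prod := by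
    rw [map_list_prod, List.map_ofFn]; rfl
  rw [h, ← Abelianization.map_of f, hx, map_one]

/-- Functoriality of `𝒦(-, n)`. -/
def calKMap {G : Type u} {H : Type v} [Group G] [Group H] (f : G →* H) (n : ℕ) :
    calK G n →* calK H n where
  toFun x := ⟨fun i => f (x.1 i), comp_mem_calK f x.2⟩
  map_one' := by ext i; simp
  map_mul' x y := by ext i; simp

/-- For a subgroup `N` of `F`, the normal closure in `Fⁿ` of `𝒦(N, n)`,
where `𝒦(N, n) ≤ Nⁿ` is regarded as a subgroup of `Fⁿ`. -/
def calKClosure {F : Type u} [Group F] (N : Subgroup F) (n : ℕ) : Subgroup (Fin n → F) :=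
  Subgroup.normalClosure ((calK N n).map (N.subtype.compLeft (Fin n)) : Set (Fin n → F))

instance calKClosure_normal {F : Type u} [Group F] (N : Subgroup F) (n : ℕ) :
    (calKClosure N n).Normal :=
  Subgroup.normalClosure_normal

theorem calKClosure_le_calK {F : Type u} [Group F] (N : Subgroup F) (n : ℕ) :
    calKClosure N n ≤ calK F n := by
  have : (calK F n).Normal := MonoidHom.normal_ker _
  refine Subgroup.normalClosure_le_normal ?_
  rintro _ ⟨x, hx, rfl⟩
  exact comp_mem_calK N.subtype hx

theorem calKClosure_ker_apply {F : Type u} {G : Type v} [Group F] [Group G] (π : F →* G) {n : ℕ}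
    {x : Fin n → F} (hx : x ∈ calKClosure π.ker n) (i : Fin n) : π (x i) = 1 := by
  have h : calKClosure π.ker n ≤ (π.comp (Pi.evalMonoidHom (fun _ : Fin n => F) i)).ker := by
    refine Subgroup.normalClosure_le_normal ?_
    rintro _ ⟨y, -, rfl⟩
    exact (y i).2
  exact h hx

/-- `𝒦̃(G, n) = 𝒦(F, n) / ⟪𝒦(N, n)⟫`, formed from a presentation `π : F → G` with `F` free, `π`
surjective and `N = ker π`; the normal closure `⟪𝒦(N, n)⟫` is taken in `Fⁿ` and lies in
`𝒦(F, n)`. -/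
abbrev KTilde {F : Type v} {G : Type u} [Group F] [Group G] (π : F →* G) (n : ℕ) : Type v :=
  calK F n ⧸ (calKClosure π.ker n).subgroupOf (calK F n)

/-- The canonical projection `𝒦̃(G, n) → 𝒦(G, n)` induced by `π`. -/
def KTilde.proj {F : Type v} {G : Type u} [Group F] [Group G] (π : F →* G) (n : ℕ) :
    KTilde π n →* calK G n :=
  QuotientGroup.lift _ (calKMap π n) fun x hx => by
    ext i
    exact calKClosure_ker_apply π (Subgroup.mem_subgroupOf.1 hx) i

/-- The homomorphism `𝒦(G, n) → Gⁿ⁻¹` that forgets the last coordinate. For `G` Abelian and `n ≥ 1`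
it is inverse to `(g₁, …, gₙ₋₁) ↦ (g₁, …, gₙ₋₁, (g₁ ⋯ gₙ₋₁)⁻¹)`, hence an isomorphism. -/
def calKInit (G : Type u) [Group G] (n : ℕ) : calK G n →* (Fin (n - 1) → G) where
  toFun x i := x.1 (Fin.castLE (Nat.sub_le n 1) i)
  map_one' := rfl
  map_mul' _ _ := rfl

/-- The trivial `G`-module `ℤ` (lifted to the universe of `G`). -/
abbrev trivialInt (G : Type u) [Group G] : Rep.{u} (ULift.{u} ℤ) G :=
  Rep.trivial (ULift.{u} ℤ) G (ULift.{u} ℤ)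

/-- The second integral homology `H₂(G, ℤ)`, written multiplicatively. -/
abbrev HTwo (G : Type u) [Group G] : Type u :=
  Multiplicative (groupHomology.H2 (trivialInt G))

/-- `ι : H₂(G, ℤ) → 𝒦̃(G, n)` is the map given by Hopf's isomorphism
`H₂(G, ℤ) ≅ (N ∩ [F, F]) / [F, N]` followed by `x ↦ (1, …, x, …, 1)`, the position of `x` being
immaterial. Hopf's isomorphism sends the class of a 2-cycle `∑ mⱼ (gⱼ, hⱼ)` to the class of
`∏ (s(gⱼ) s(hⱼ) s(gⱼhⱼ)⁻¹) ^ mⱼ`, where `s` is a set-theoretic section of `π`. -/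
def IsHopfMap {F : Type v} {G : Type u} [Group F] [Group G] (π : F →* G) (n : ℕ)
    (ι : HTwo G →* KTilde π n) : Prop :=
  ∀ (s : G → F), Function.RightInverse s π →
  ∀ (L : List ((G × G) × ℤ)) (c : groupHomology.cycles₂ (trivialInt G)),
    (c : G × G →₀ ULift.{u} ℤ) = (L.map fun t => Finsupp.single t.1 (ULift.up t.2)).sum →
  ∀ i : Fin n, ∃ y : calK F n,
    (y : Fin n → F) = Pi.mulSingle i
      (L.map fun t => (s t.1.1 * s t.1.2 * (s (t.1.1 * t.1.2))⁻¹) ^ t.2).prod ∧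
    ι (Multiplicative.ofAdd ((groupHomology.H2π (trivialInt G)).hom c)) = QuotientGroup.mk y

/-! Write N for the kernel of π. Modulo [F, N], the product of the coordinates is a
conjugation-invariant homomorphism on Nⁿ, and for n ≥ 2 the closure of 𝒦(N, n) consists of the
tuples in Nⁿ whose product lies in [F, N]. Hence placing x in one coordinate embeds (N ∩ [F, F]) /
[F, N] in 𝒦̃(G, n), with central image. For abelian G, a tuple of 𝒦(F, n) that dies in Gⁿ⁻¹ has all
coordinates in N and is congruent to its product in one coordinate. So this image is the kernel of
the map to Gⁿ⁻¹ (`KTilde.init_ker`).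

Hopf's formula (`exists_hopf`) is proved on cycles: the factor set of the central extension F/[F, N]
→ G is evaluated on 2-cycles. Injectivity uses that every 2-cocycle of G becomes a coboundary on the
free group F, with a bounding cochain that factors through F/[F, N].

The kernel contains the commutator subgroup because Gⁿ⁻¹ is abelian. Conversely, for n ≥ 3 a
commutator in one coordinate is a commutator in 𝒦(F, n). Centrality bounds the class by 2; a cup
product of two characters shows that H₂ is nontrivial in the noncyclic case. Finally, a central
commutator subgroup lies in the Frattini subgroup, which is therefore the preimage of Φ(Gⁿ⁻¹) =
Φ(G)ⁿ⁻¹. -/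

open groupHomology

/-! ### Group extensions from 2-cocycles, and their splitting over free groups -/

/-- The extension of `G` by the abelian group `Q` defined by a 2-cocycle for the trivial action. -/
@[ext]
structure CocycleExtension {G Q : Type*} [Group G] [AddCommGroup Q] (τ : G → G → Q) where
  /-- The component in the kernel. -/
  fst : Q
  /-- The component in the quotient. -/
  snd : G

/-- The 2-cocycle condition for the trivial action. -/
def IsTrivialCocycle {G Q : Type*} [Group G] [AddCommGroup Q] (τ : G → G → Q) : Prop :=
  ∀ g h k, τ g h + τ (g * h) k = τ h k + τ g (h * k)

namespace IsTrivialCocycle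

variable {G Q : Type*} [Group G] [AddCommGroup Q] {τ : G → G → Q}

theorem one_left (hτ : IsTrivialCocycle τ) (g : G) : τ 1 g = τ 1 1 := by
  have := hτ 1 1 g
  simpa [eq_comm] using this

theorem one_right (hτ : IsTrivialCocycle τ) (g : G) : τ g 1 = τ 1 1 := by
  have := hτ g 1 1
  simpa using this

/-- The group structure on the extension defined by a 2-cocycle. -/
@[reducible]
def group (hτ : IsTrivialCocycle τ) : Group (CocycleExtension τ) :=
  letI : Mul (CocycleExtension τ) := ⟨fun x y => ⟨x.fst + y.fst + τ x.snd y.snd, x.snd * y.snd⟩⟩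
  letI : One (CocycleExtension τ) := ⟨⟨-τ 1 1, 1⟩⟩
  letI : Inv (CocycleExtension τ) :=
    ⟨fun x => ⟨-x.fst - τ x.snd⁻¹ x.snd - τ 1 1, x.snd⁻¹⟩⟩
  Group.ofLeftAxioms
    (fun x y z => by
      refine CocycleExtension.ext ?_ (mul_assoc _ _ _)
      change x.fst + y.fst + τ x.snd y.snd + z.fst + τ (x.snd * y.snd) z.snd =
        x.fst + (y.fst + z.fst + τ y.snd z.snd) + τ x.snd (y.snd * z.snd)
      have h := hτ x.snd y.snd z.snd
      rw [← sub_eq_zero] at h ⊢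
      rw [← h]
      abel)
    (fun x => by
      refine CocycleExtension.ext ?_ (one_mul _)
      change -τ 1 1 + x.fst + τ 1 x.snd = x.fst
      rw [hτ.one_left x.snd]; abel)
    (fun x => by
      refine CocycleExtension.ext ?_ (inv_mul_cancel _)
      change -x.fst - τ x.snd⁻¹ x.snd - τ 1 1 + x.fst + τ x.snd⁻¹ x.snd = -τ 1 1
      abel)

end IsTrivialCocycle

/-- The pullback of a 2-cocycle along a presentation becomes a coboundary modulo `[F, N]`. -/
theorem IsTrivialCocycle.exists_cobounding {F G Q : Type*} [Group F] [Group G] [IsFreeGroup F]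
    [AddCommGroup Q] {τ : G → G → Q} (hτ : IsTrivialCocycle τ) (π : F →* G) :
    ∃ r : F ⧸ ⁅(⊤ : Subgroup F), π.ker⁆ → Q, ∀ x y : F,
      r (x * y : F) = r x + r y + τ (π x) (π y) := by
  let _ := hτ.group
  let θ : F →* CocycleExtension τ := IsFreeGroup.lift fun a => ⟨0, π (IsFreeGroup.of a)⟩
  let snd : CocycleExtension τ →* G := MonoidHom.mk' CocycleExtension.snd fun _ _ => rfl
  have hsnd : snd.comp θ = π := IsFreeGroup.ext_hom fun a => by
    rw [MonoidHom.comp_apply, IsFreeGroup.lift_of]; rfl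
  have hs (x : F) : (θ x).snd = π x := DFunLike.congr_fun hsnd x
  -- The image of N lies over 1 ∈ G, hence in the central copy of Q, so commutators with it die.
  have hk : ⁅(⊤ : Subgroup F), π.ker⁆ ≤ θ.ker := by
    rw [Subgroup.commutator_le]
    intro x _ y hy
    rw [MonoidHom.mem_ker, map_commutatorElement, commutatorElement_eq_one_iff_mul_comm]
    have hy : (θ y).snd = 1 := (hs y).trans hy
    refine CocycleExtension.ext ?_ ?_
    · change (θ x).fst + (θ y).fst + τ (θ x).snd (θ y).snd =
        (θ y).fst + (θ x).fst + τ (θ y).snd (θ x).snd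
      rw [hy, hτ.one_left, hτ.one_right, add_comm (θ x).fst]
    · change (θ x).snd * (θ y).snd = (θ y).snd * (θ x).snd
      rw [hy, mul_one, one_mul]
  refine ⟨fun e => (QuotientGroup.lift _ θ hk e).fst, fun x y => ?_⟩
  beta_reduce
  rw [QuotientGroup.lift_mk, QuotientGroup.lift_mk, QuotientGroup.lift_mk, map_mul, ← hs, ← hs]
  rfl

/-! ### Evaluating cocycles and coboundaries on 2-chains -/

section LinearCombination

variable {X M M' : Type*} [AddCommGroup M] [AddCommGroup M']

theorem map_linearCombination_uliftInt (φ : M →+ M') (v : X → M) (x : X →₀ ULift ℤ) :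
    φ (Finsupp.linearCombination (ULift ℤ) v x) =
      Finsupp.linearCombination (ULift ℤ) (fun i => φ (v i)) x := by
  induction x using Finsupp.induction_linear with
  | zero => simp
  | add a b ha hb => simp only [map_add, ha, hb]
  | single i a =>
    rw [Finsupp.linearCombination_single, Finsupp.linearCombination_single]
    exact map_zsmul φ a.down (v i)

variable {G : Type*} [Group G]

theorem linearCombination_eq_zero_of_mem_boundaries₂ {τ : G → G → M} (hτ : IsTrivialCocycle τ)
    {x : G × G →₀ ULift ℤ} (hx : x ∈ boundaries₂ (trivialInt G)) :
    Finsupp.linearCombination (ULift ℤ) (fun t : G × G => τ t.1 t.2) x = 0 := by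
  obtain ⟨y, rfl⟩ := hx
  induction y using Finsupp.induction_linear with
  | zero => simp
  | add a b ha hb => simp only [map_add, ha, hb, add_zero]
  | single t a =>
    change ULift ℤ at a
    have h := d₃₂_single (A := trivialInt G) t a
    erw [h]
    simp only [map_add, map_sub, Finsupp.linearCombination_single, Representation.isTrivial_apply]
    have h := hτ t.1 t.2.1 t.2.2
    rw [← sub_eq_zero] at h
    rw [← smul_sub, ← smul_add, ← smul_sub, ← neg_eq_zero, ← smul_neg,
      ← smul_zero a, ← h]
    congr 1
    abel

theorem linearCombination_coboundary (t : G → M) (x : G × G →₀ ULift ℤ) :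
    Finsupp.linearCombination (ULift ℤ) (fun y : G × G => t y.1 + t y.2 - t (y.1 * y.2)) x =
      Finsupp.linearCombination (ULift ℤ) t ((d₂₁ (trivialInt G)).hom x) := by
  induction x using Finsupp.induction_linear with
  | zero => simp
  | add a b ha hb => simp only [map_add, ha, hb]
  | single y a =>
    have h := d₂₁_single (A := trivialInt G) y a
    erw [h]
    simp only [map_add, map_sub, Finsupp.linearCombination_single, Representation.isTrivial_apply]
    rw [← smul_sub, ← smul_add]
    congr 1
    abel

end LinearCombination

/-- A map to an abelian group that is additive modulo a subgroup sends commutators into it. -/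
theorem mem_of_mem_commutator_of_add_mem {E B : Type*} [Group E] [AddCommGroup B]
    (R : AddSubgroup B) (φ : E → B) (h : ∀ x y, -φ (x * y) + (φ x + φ y) ∈ R) {e : E}
    (he : e ∈ commutator E) : φ e ∈ R := by
  let Ψ : Additive E →+ B ⧸ R := AddMonoidHom.mk' (fun e => QuotientAddGroup.mk (φ e.toMul))
    fun x y => QuotientAddGroup.eq.2 (h x.toMul y.toMul)
  have hΨ : commutator E ≤ (AddMonoidHom.toMultiplicativeRight Ψ).ker :=
    Abelianization.commutator_subset_ker _
  exact (QuotientAddGroup.eq_zero_iff _).1 (hΨ he)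

/-! ### Factor sets of a central extension, evaluated on 2-cycles -/

section CentralExtension

variable {E : Type*} {G : Type u} [Group E] [Group G]

/-- The part of the kernel of `p` that is contained in the center. -/
abbrev centralKer (p : E →* G) : Subgroup (Subgroup.center E) :=
  p.ker.subgroupOf (Subgroup.center E)

instance centralKer.commGroup (p : E →* G) : CommGroup (centralKer p) :=
  { (inferInstance : Group (centralKer p)) with
    mul_comm := fun a b => Subtype.ext (Subtype.ext (Subgroup.mem_center_iff.1 b.1.2 a.1.1)) }

/-- The inclusion of the central part of the kernel. -/
abbrev centralKerIncl (p : E →* G) : centralKer p →* E :=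
  (Subgroup.center E).subtype.comp (centralKer p).subtype

theorem centralKerIncl_injective (p : E →* G) : Function.Injective (centralKerIncl p) :=
  Subtype.val_injective.comp Subtype.val_injective

theorem centralKerIncl_mul_comm (p : E →* G) (k : centralKer p) (e : E) :
    e * centralKerIncl p k = centralKerIncl p k * e :=
  Subgroup.mem_center_iff.1 k.1.2 e

variable {p : E →* G}

theorem section_mul_mem_ker {s : G → E} (hs : Function.RightInverse s p) (g h : G) :
    s g * s h * (s (g * h))⁻¹ ∈ p.ker := by
  rw [MonoidHom.mem_ker, map_mul, map_mul, map_inv, hs, hs, hs, mul_inv_cancel]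

/-- The factor set of a central extension with respect to a section. -/
def factorSet (hp : p.ker ≤ Subgroup.center E) {s : G → E} (hs : Function.RightInverse s p)
    (g h : G) : centralKer p :=
  ⟨⟨s g * s h * (s (g * h))⁻¹, hp (section_mul_mem_ker hs g h)⟩, section_mul_mem_ker hs g h⟩

/-- The linear extension of the factor set to 2-chains. -/
noncomputable def factorMap (hp : p.ker ≤ Subgroup.center E) {s : G → E}
    (hs : Function.RightInverse s p) :
    (G × G →₀ ULift ℤ) →ₗ[ULift ℤ] Additive (centralKer p) :=
  Finsupp.linearCombination (ULift ℤ) fun t : G × G => Additive.ofMul (factorSet hp hs t.1 t.2)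

variable (hp : p.ker ≤ Subgroup.center E) {s : G → E} (hs : Function.RightInverse s p)

theorem centralKerIncl_factorSet (g h : G) :
    centralKerIncl p (factorSet hp hs g h) = s g * s h * (s (g * h))⁻¹ := rfl

theorem factorSet_isTrivialCocycle :
    IsTrivialCocycle fun g h => Additive.ofMul (factorSet hp hs g h) := by
  intro g h k
  apply Additive.toMul.injective
  apply centralKerIncl_injective p
  simp only [← ofMul_mul, toMul_ofMul, map_mul (centralKerIncl p)]
  have h1 := centralKerIncl_mul_comm p (factorSet hp hs h k) (s g)
  simp only [centralKerIncl_factorSet] at h1 ⊢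
  rw [mul_assoc (s g) (s (h * k)), ← mul_assoc _ (s g), ← h1, mul_assoc g h k]
  group

theorem centralKerIncl_factorMap_list (L : List ((G × G) × ℤ)) :
    centralKerIncl p (factorMap hp hs
      (L.map fun t => Finsupp.single t.1 (ULift.up t.2)).sum).toMul =
      (L.map fun t => (s t.1.1 * s t.1.2 * (s (t.1.1 * t.1.2))⁻¹) ^ t.2).prod := by
  induction L with
  | nil => simp
  | cons t L ih =>
    rw [List.map_cons, List.sum_cons, map_add, toMul_add, map_mul, ih, List.map_cons,
      List.prod_cons, factorMap, Finsupp.linearCombination_single]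
    congr 1

theorem factorMap_eq_zero_of_mem_boundaries₂ {x : G × G →₀ ULift ℤ}
    (hx : x ∈ boundaries₂ (trivialInt G)) : factorMap hp hs x = 0 :=
  linearCombination_eq_zero_of_mem_boundaries₂ (factorSet_isTrivialCocycle hp hs) hx

/-- In the abelianization of E the factor set becomes the coboundary of g ↦ [s g], which vanishes on
cycles. -/
theorem factorMap_mem_commutator {x : G × G →₀ ULift ℤ} (hx : x ∈ cycles₂ (trivialInt G)) :
    centralKerIncl p (factorMap hp hs x).toMul ∈ commutator E := by
  have hx : (d₂₁ (trivialInt G)).hom x = 0 := hx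
  let φ : Additive (centralKer p) →+ Additive (Abelianization E) :=
    (Abelianization.of.comp (centralKerIncl p)).toAdditive
  have h := map_linearCombination_uliftInt φ
    (fun t : G × G => Additive.ofMul (factorSet hp hs t.1 t.2)) x
  have h2 := linearCombination_coboundary
    (fun g => Additive.ofMul (Abelianization.of (s g))) x
  rw [hx, map_zero] at h2
  rw [← Abelianization.ker_of]
  have h3 : φ (factorMap hp hs x) = 0 := by
    rw [factorMap, h, ← h2]
    congr 2
    funext t
    change Additive.ofMul (Abelianization.of (s t.1 * s t.2 * (s (t.1 * t.2))⁻¹)) = _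
    rw [map_mul Abelianization.of, map_mul Abelianization.of, map_inv Abelianization.of,
      ← div_eq_mul_inv]
    rfl
  exact h3

/-- Two sections differ by a central function t, so their factor sets differ by the coboundary of t.
-/
theorem factorMap_eq_of_mem_cycles₂ {s' : G → E} (hs' : Function.RightInverse s' p)
    {x : G × G →₀ ULift ℤ} (hx : x ∈ cycles₂ (trivialInt G)) :
    factorMap hp hs' x = factorMap hp hs x := by
  have hx : (d₂₁ (trivialInt G)).hom x = 0 := hx
  have hm (g : G) : s' g * (s g)⁻¹ ∈ p.ker := by
    rw [MonoidHom.mem_ker, map_mul, map_inv, hs, hs', mul_inv_cancel]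
  let t (g : G) : centralKer p := ⟨⟨_, hp (hm g)⟩, hm g⟩
  have ht (g : G) : s' g = centralKerIncl p (t g) * s g := (inv_mul_cancel_right _ _).symm
  have h2 := linearCombination_coboundary (fun g => Additive.ofMul (t g)) x
  rw [hx, map_zero] at h2
  rw [← sub_eq_zero, ← h2, factorMap, factorMap, ← LinearMap.sub_apply]
  congr 1
  ext1 y
  refine LinearMap.ext_ring ?_
  simp only [LinearMap.comp_apply, LinearMap.sub_apply, Finsupp.lsingle_apply,
    Finsupp.linearCombination_single, one_smul]
  rw [sub_eq_iff_eq_add, sub_add_eq_add_sub, eq_sub_iff_add_eq]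
  apply Additive.toMul.injective
  apply centralKerIncl_injective p
  simp only [← ofMul_mul, toMul_ofMul, map_mul (centralKerIncl p)]
  rw [centralKerIncl_factorSet, centralKerIncl_factorSet, ht, ht, ht, mul_inv_rev]
  have h1 := centralKerIncl_mul_comm p (t y.2) (s y.1)
  have h3 := centralKerIncl_mul_comm p (t (y.1 * y.2)) (s (y.1 * y.2))⁻¹
  rw [mul_assoc _ _ (centralKerIncl p (t (y.1 * y.2))),
    mul_assoc _ _ (centralKerIncl p (t (y.1 * y.2))),
    inv_mul_cancel, mul_one, mul_assoc _ (s y.1), ← mul_assoc (s y.1), h1]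
  group

theorem exists_factorMap_eq {k : centralKer p} (hk : centralKerIncl p k ∈ commutator E) :
    ∃ x ∈ cycles₂ (trivialInt G), factorMap hp hs x = Additive.ofMul k := by
  -- R consists of the pairs (∂c, -f(c)), where f is `factorMap`. Writing e = a(e) s(p e), the map e
  -- ↦ ([p e], a(e)) is additive modulo R, so it sends k ∈ [E, E] into R.
  let R : AddSubgroup ((G →₀ ULift ℤ) × Additive (centralKer p)) :=
    (AddMonoidHom.prod (d₂₁ (trivialInt G)).hom.toAddMonoidHom
      (-(factorMap hp hs).toAddMonoidHom)).range
  have hm (e : E) : e * (s (p e))⁻¹ ∈ p.ker := by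
    rw [MonoidHom.mem_ker, map_mul, map_inv, hs, mul_inv_cancel]
  let a (e : E) : centralKer p := ⟨⟨_, hp (hm e)⟩, hm e⟩
  have ha (e : E) : centralKerIncl p (a e) = e * (s (p e))⁻¹ := rfl
  have hd (g h : G) : (d₂₁ (trivialInt G)).hom (Finsupp.single (g, h) (1 : ULift ℤ)) =
      Finsupp.single h (1 : ULift ℤ) - Finsupp.single (g * h) 1 + Finsupp.single g 1 :=
    d₂₁_single (A := trivialInt G) (g, h) (1 : ULift ℤ)
  have hf (g h : G) : factorMap hp hs (Finsupp.single (g, h) (1 : ULift ℤ)) =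
      Additive.ofMul (factorSet hp hs g h) := by
    rw [factorMap, Finsupp.linearCombination_single, one_smul]
  obtain ⟨c, hc⟩ := mem_of_mem_commutator_of_add_mem R
    (fun e => (Finsupp.single (p e) (1 : ULift ℤ), Additive.ofMul (a e))) (by
    intro e e'
    refine ⟨Finsupp.single (p e, p e') (1 : ULift ℤ), ?_⟩
    refine Prod.ext ?_ ?_
    · change (d₂₁ (trivialInt G)).hom (Finsupp.single (p e, p e') (1 : ULift ℤ)) =
        -Finsupp.single (p (e * e')) 1 + (Finsupp.single (p e) 1 + Finsupp.single (p e') 1)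
      rw [hd, map_mul]
      abel
    · change -factorMap hp hs (Finsupp.single (p e, p e') (1 : ULift ℤ)) =
        -Additive.ofMul (a (e * e')) + (Additive.ofMul (a e) + Additive.ofMul (a e'))
      rw [hf, eq_neg_add_iff_add_eq, ← sub_eq_add_neg, sub_eq_iff_eq_add]
      apply Additive.toMul.injective
      apply centralKerIncl_injective p
      simp only [← ofMul_mul, toMul_ofMul, map_mul (centralKerIncl p)]
      rw [centralKerIncl_factorSet, ha (e * e'), ha e, mul_assoc e (s (p e))⁻¹,
        centralKerIncl_mul_comm p (a e') (s (p e))⁻¹, ha e', map_mul]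
      group) hk
  have hpk : p (centralKerIncl p k) = 1 := k.2
  have hc1 : (d₂₁ (trivialInt G)).hom c = Finsupp.single (1 : G) (1 : ULift ℤ) :=
    (congrArg Prod.fst hc).trans (by rw [hpk])
  have hc2 : -factorMap hp hs c = Additive.ofMul (a (centralKerIncl p k)) :=
    congrArg Prod.snd hc
  -- Since s need not be normalized, a(k) = k s(1)⁻¹ and ∂c = [1]. The chain (1, 1) has boundary [1]
  -- and value s(1), which corrects both.
  refine ⟨Finsupp.single (1, 1) 1 - c, ?_, ?_⟩
  · change (d₂₁ (trivialInt G)).hom (Finsupp.single (1, 1) (1 : ULift ℤ) - c) = 0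
    rw [map_sub, hc1, hd, mul_one]
    abel
  · rw [map_sub, sub_eq_add_neg, hc2, hf]
    apply Additive.toMul.injective
    apply centralKerIncl_injective p
    simp only [← ofMul_mul, toMul_ofMul, map_mul (centralKerIncl p)]
    rw [centralKerIncl_factorSet, ha, hpk, ← centralKerIncl_mul_comm, mul_one,
      mul_inv_cancel_right, mul_inv_cancel_left]

/-- Test against the universal cocycle, with values in 2-chains modulo boundaries. A cochain
bounding its pullback to E restricts, up to a constant, to a homomorphism on the central kernel that
carries `factorMap` of a cycle to the class of that cycle. -/
theorem mem_boundaries₂_of_factorMap_eq_zero {x : G × G →₀ ULift ℤ}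
    (hx : x ∈ cycles₂ (trivialInt G)) (hfx : factorMap hp hs x = 0)
    (hE : ∀ (τ : G → G → (G × G →₀ ULift ℤ) ⧸ boundaries₂ (trivialInt G)),
      IsTrivialCocycle τ → ∃ r : E → (G × G →₀ ULift ℤ) ⧸ boundaries₂ (trivialInt G),
        ∀ x y : E, r (x * y) = r x + r y + τ (p x) (p y)) :
    x ∈ boundaries₂ (trivialInt G) := by
  have hx : (d₂₁ (trivialInt G)).hom x = 0 := hx
  let τ (g h : G) : (G × G →₀ ULift ℤ) ⧸ boundaries₂ (trivialInt G) :=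
    (boundaries₂ (trivialInt G)).mkQ (Finsupp.single (g, h) 1)
  have hτ : IsTrivialCocycle τ := by
    intro g h k
    have hd : (d₃₂ (trivialInt G)).hom (Finsupp.single (g, h, k) (1 : ULift ℤ)) =
        Finsupp.single (h, k) (1 : ULift ℤ) - Finsupp.single (g * h, k) 1 +
          Finsupp.single (g, h * k) 1 - Finsupp.single (g, h) 1 :=
      d₃₂_single (A := trivialInt G) (g, h, k) (1 : ULift ℤ)
    have h0 : (boundaries₂ (trivialInt G)).mkQ
        ((d₃₂ (trivialInt G)).hom (Finsupp.single (g, h, k) (1 : ULift ℤ))) = 0 :=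
      (Submodule.Quotient.mk_eq_zero _).2 ⟨_, rfl⟩
    rw [hd, map_sub, map_add, map_sub] at h0
    rw [eq_comm, ← sub_eq_zero, ← h0]
    change _ + _ - (_ + _) = _ - _ + _ - _
    abel
  obtain ⟨r, hr⟩ := hE τ hτ
  -- On the central kernel r satisfies r(kl) = r(k) + r(l) + τ 1 1; the shift by τ 1 1 makes it
  -- additive.
  let ρ : Additive (centralKer p) →+ (G × G →₀ ULift ℤ) ⧸ boundaries₂ (trivialInt G) :=
    AddMonoidHom.mk' (fun k => r (centralKerIncl p k.toMul) + τ 1 1) <| by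
      intro k l
      have hk : p (centralKerIncl p k.toMul) = 1 := k.toMul.2
      have hl : p (centralKerIncl p l.toMul) = 1 := l.toMul.2
      rw [toMul_add, map_mul, hr, hk, hl]
      abel
  have hρ (g h : G) : ρ (Additive.ofMul (factorSet hp hs g h)) =
      τ g h + (r (s g) + r (s h) - r (s (g * h))) := by
    have h1 := hr (centralKerIncl p (factorSet hp hs g h)) (s (g * h))
    rw [centralKerIncl_factorSet, inv_mul_cancel_right, hr, hs, hs, hs,
      ← centralKerIncl_factorSet hp hs,
      show p (centralKerIncl p (factorSet hp hs g h)) = 1 from (factorSet hp hs g h).2,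
      hτ.one_left] at h1
    change r (centralKerIncl p (factorSet hp hs g h)) + τ 1 1 = _
    rw [eq_comm, add_sub, sub_eq_iff_eq_add]
    rw [add_comm (τ g h), h1]
    abel
  have h1 := map_linearCombination_uliftInt ρ
    (fun t : G × G => Additive.ofMul (factorSet hp hs t.1 t.2)) x
  have h2 := linearCombination_coboundary (fun g => r (s g)) x
  have h3 := map_linearCombination_uliftInt (boundaries₂ (trivialInt G)).mkQ.toAddMonoidHom
    (fun t : G × G => Finsupp.single t (1 : ULift ℤ)) x
  rw [hx, map_zero] at h2
  rw [show Finsupp.linearCombination (ULift ℤ) _ x = factorMap hp hs x from rfl,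
    hfx, map_zero] at h1
  have h4 (y : G × G →₀ ULift.{u} ℤ) :
      Finsupp.linearCombination (ULift ℤ) (fun t : G × G => Finsupp.single t (1 : ULift ℤ)) y
        = y := by
    induction y using Finsupp.induction_linear with
    | zero => simp
    | add a b ha hb => rw [map_add, ha, hb]
    | single y a =>
      rw [Finsupp.linearCombination_single, Finsupp.smul_single, smul_eq_mul, mul_one]
  -- By `hρ`, τ and ρ of the factor set differ by the coboundary of r ∘ s, which contributes nothing
  -- on the cycle x.
  have h5 : Finsupp.linearCombination (ULift ℤ) (fun t : G × G => τ t.1 t.2) x = 0 := by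
    rw [← add_zero (Finsupp.linearCombination _ _ _), ← h2, ← LinearMap.add_apply]
    refine Eq.trans ?_ (h1.symm.trans h2.symm)
    congr 1
    ext1 y
    refine LinearMap.ext_ring ?_
    simp only [LinearMap.comp_apply, LinearMap.add_apply, Finsupp.lsingle_apply,
      Finsupp.linearCombination_single, one_smul, hρ]
  rw [← Submodule.Quotient.mk_eq_zero]
  rw [h4] at h3
  exact h3.trans h5

end CentralExtension

/-- Lift u through q and apply j; the choice of lift is immaterial because ker q ≤ ker j. It serves
to descend from cycles to homology, and to pass from F/[F, N] to 𝒦̃(G, n). -/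
theorem exists_monoidHom_of_range_le_of_ker_le {Z S E T : Type*} [Group Z] [Group S] [Group E]
    [Group T] (u : Z →* E) (q : S →* E) (j : S →* T) (h : u.range ≤ q.range) (hk : q.ker ≤ j.ker) :
    ∃ f : Z →* T, ∀ z x, q x = u z → f z = j x := by
  refine ⟨((QuotientGroup.lift q.ker j hk).comp
    (QuotientGroup.quotientKerEquivRange q).symm.toMonoidHom).comp
      ((Subgroup.inclusion h).comp u.rangeRestrict), fun z x hx => ?_⟩
  have : (QuotientGroup.quotientKerEquivRange q).symm
      ((Subgroup.inclusion h) (u.rangeRestrict z)) = (x : S ⧸ q.ker) := by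
    rw [MulEquiv.symm_apply_eq]
    exact Subtype.ext hx.symm
  change QuotientGroup.lift q.ker j hk ((QuotientGroup.quotientKerEquivRange q).symm
      ((Subgroup.inclusion h) (u.rangeRestrict z))) = _
  rw [this, QuotientGroup.lift_mk]

/-! ### Hopf's formula -/

section Hopf

variable {F : Type v} {G : Type u} [Group F] [Group G] (π : F →* G)

/-- The central extension of `G` obtained from a presentation with kernel `N` by dividing
out `[F, N]`. -/
def centralExtensionHom : F ⧸ ⁅(⊤ : Subgroup F), π.ker⁆ →* G :=
  QuotientGroup.lift _ π (Subgroup.commutator_le_right _ _)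

theorem centralExtensionHom_ker_le_center :
    (centralExtensionHom π).ker ≤ Subgroup.center (F ⧸ ⁅(⊤ : Subgroup F), π.ker⁆) := by
  intro x hx
  induction x using QuotientGroup.induction_on with | H x
  rw [Subgroup.mem_center_iff]
  intro y
  induction y using QuotientGroup.induction_on with | H y
  rw [← QuotientGroup.mk_mul, ← QuotientGroup.mk_mul, QuotientGroup.eq]
  have h := Subgroup.commutator_mem_commutator (Subgroup.mem_top (y⁻¹ : F))
    (π.ker.inv_mem (show x ∈ π.ker from hx))
  have := Subgroup.inv_mem _ h
  rw [commutatorElement_inv, commutatorElement_def] at this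
  convert this using 1
  group

/-- Hopf's formula for the second homology of `G`, with the explicit map on 2-cycles. -/
theorem exists_hopf [IsFreeGroup F] (hπ : Function.Surjective π) :
    ∃ u : HTwo G →* F ⧸ ⁅(⊤ : Subgroup F), π.ker⁆, Function.Injective u ∧
      u.range = (π.ker ⊓ commutator F).map (QuotientGroup.mk' _) ∧
      ∀ (s : G → F), Function.RightInverse s π → ∀ (L : List ((G × G) × ℤ))
        (c : cycles₂ (trivialInt G)),
        (c : G × G →₀ ULift.{u} ℤ) =
          (L.map fun t => Finsupp.single t.1 (ULift.up t.2)).sum →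
        u (Multiplicative.ofAdd ((H2π (trivialInt G)).hom c)) =
          ((L.map fun t => (s t.1.1 * s t.1.2 * (s (t.1.1 * t.1.2))⁻¹) ^ t.2).prod : F) := by
  set p := centralExtensionHom π with hp_def
  have hp := centralExtensionHom_ker_le_center π
  rw [← hp_def] at hp
  let s₀ (g : G) : F ⧸ ⁅(⊤ : Subgroup F), π.ker⁆ := (Function.surjInv hπ g : F)
  have hs₀ : Function.RightInverse s₀ p := Function.surjInv_eq hπ
  let q : Multiplicative (cycles₂ (trivialInt G)) →* HTwo G :=
    AddMonoidHom.toMultiplicative (H2π (trivialInt G)).hom.toAddMonoidHom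
  let v : Multiplicative (cycles₂ (trivialInt G)) →* F ⧸ ⁅(⊤ : Subgroup F), π.ker⁆ :=
    (centralKerIncl p).comp (AddMonoidHom.toMultiplicativeLeft
      ((factorMap hp hs₀).toAddMonoidHom.comp (cycles₂ (trivialInt G)).subtype.toAddMonoidHom))
  have hv (c : cycles₂ (trivialInt G)) :
      v (Multiplicative.ofAdd c) = centralKerIncl p (factorMap hp hs₀ c.1).toMul := rfl
  have hq (c : cycles₂ (trivialInt G)) : q (Multiplicative.ofAdd c) = 1 ↔
      (c : G × G →₀ ULift.{u} ℤ) ∈ boundaries₂ (trivialInt G) := H2π_eq_zero_iff c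
  have hqs : Function.Surjective q := by
    intro z
    obtain ⟨c, hc⟩ : ∃ c, (H2π (trivialInt G)).hom c = Multiplicative.toAdd z :=
      H2_induction_on (C := fun z => ∃ c, (H2π (trivialInt G)).hom c = z) _ fun c => ⟨c, rfl⟩
    exact ⟨Multiplicative.ofAdd c, hc⟩
  obtain ⟨u, hu⟩ := exists_monoidHom_of_range_le_of_ker_le (MonoidHom.id (HTwo G)) q v
    (fun z _ => hqs z) (by
      intro c hc
      have := factorMap_eq_zero_of_mem_boundaries₂ hp hs₀ ((hq c.toAdd).1 hc)
      change v (Multiplicative.ofAdd c.toAdd) = 1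
      rw [hv, this, toMul_zero, map_one])
  have huq (c : cycles₂ (trivialInt G)) : u (q (Multiplicative.ofAdd c)) =
      centralKerIncl p (factorMap hp hs₀ c.1).toMul := hu _ _ rfl
  refine ⟨u, ?_, ?_, ?_⟩
  · rw [injective_iff_map_eq_one]
    intro z hz
    obtain ⟨c, rfl⟩ := hqs z
    induction c using Multiplicative.rec with | ofAdd c
    rw [huq] at hz
    rw [hq]
    refine mem_boundaries₂_of_factorMap_eq_zero hp hs₀ c.2 ?_ ?_
    · exact Additive.toMul.injective
        (centralKerIncl_injective p (hz.trans (map_one (centralKerIncl p)).symm))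
    · intro τ hτ
      obtain ⟨r, hr⟩ := hτ.exists_cobounding π
      refine ⟨r, fun x y => ?_⟩
      induction x using QuotientGroup.induction_on with | H x
      induction y using QuotientGroup.induction_on with | H y
      exact hr x y
  · have hcomm : commutator (F ⧸ ⁅(⊤ : Subgroup F), π.ker⁆) =
        (commutator F).map (QuotientGroup.mk' _) := by
      rw [commutator_def, commutator_def, Subgroup.map_commutator,
        Subgroup.map_top_of_surjective _ (QuotientGroup.mk'_surjective _)]
    apply le_antisymm
    · rintro _ ⟨z, rfl⟩
      obtain ⟨c, rfl⟩ := hqs z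
      induction c using Multiplicative.rec with | ofAdd c
      have h1 := factorMap_mem_commutator hp hs₀ c.2
      rw [hcomm, ← huq] at h1
      obtain ⟨x, hx, hx'⟩ := h1
      refine ⟨x, ⟨?_, hx⟩, hx'⟩
      have h2 : p (u (q (Multiplicative.ofAdd c))) = 1 := by
        rw [huq]
        exact (factorMap hp hs₀ c.1).toMul.2
      rw [← hx'] at h2
      exact h2
    · rintro _ ⟨x, ⟨hx, hx'⟩, rfl⟩
      have hx : ((x : F) : F ⧸ ⁅(⊤ : Subgroup F), π.ker⁆) ∈ p.ker := hx
      obtain ⟨c, hc, hcx⟩ := exists_factorMap_eq hp hs₀ (k := ⟨⟨_, hp hx⟩, hx⟩)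
        (hcomm ▸ Subgroup.mem_map_of_mem _ hx')
      refine ⟨q (Multiplicative.ofAdd ⟨c, hc⟩), ?_⟩
      rw [huq, hcx]
      rfl
  · intro s hs L c hc
    have hs' : Function.RightInverse (fun g => (s g : F ⧸ ⁅(⊤ : Subgroup F), π.ker⁆)) p := hs
    refine (huq c).trans ?_
    -- u was built from one fixed section; on cycles every other section gives the same value.
    rw [← factorMap_eq_of_mem_cycles₂ hp hs₀ hs' c.2]
    refine (congrArg (fun x => centralKerIncl p (factorMap hp hs' x).toMul) hc).trans ?_
    rw [centralKerIncl_factorMap_list, ← QuotientGroup.mk'_apply, map_list_prod, List.map_map]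
    rfl

end Hopf

/-! ### The normal closure of 𝒦(N, n) and the product of coordinates -/

theorem List.prod_ofFn_one {M : Type*} [Monoid M] {n : ℕ} :
    (List.ofFn (1 : Fin n → M)).prod = 1 := by
  rw [show (1 : Fin n → M) = fun _ => 1 from rfl, List.ofFn_const, List.prod_replicate, one_pow]

section Closure

variable {F : Type v} [Group F] (N : Subgroup F) {n : ℕ}

/-- Elements of `N` are central modulo `[F, N]`. -/
theorem mk_mul_comm_of_mem [N.Normal] {x : F} (hx : x ∈ N) (y : F ⧸ ⁅(⊤ : Subgroup F), N⁆) :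
    (x : F ⧸ ⁅(⊤ : Subgroup F), N⁆) * y = y * x := by
  induction y using QuotientGroup.induction_on with | H y
  rw [← QuotientGroup.mk_mul, ← QuotientGroup.mk_mul, eq_comm, QuotientGroup.eq]
  have h := Subgroup.inv_mem _ (Subgroup.commutator_mem_commutator (Subgroup.mem_top (y⁻¹ : F))
    (N.inv_mem hx))
  rw [commutatorElement_inv, commutatorElement_def] at h
  convert h using 1
  group

theorem commutator_le_commutator_top_self : ⁅N, N⁆ ≤ ⁅(⊤ : Subgroup F), N⁆ :=
  Subgroup.commutator_mono le_top le_rfl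

theorem list_prod_ofFn_mem {x : Fin n → F} (hx : ∀ i, x i ∈ N) : (List.ofFn x).prod ∈ N :=
  N.list_prod_mem fun a ha => by
    obtain ⟨i, rfl⟩ := (List.mem_ofFn' _ _).1 ha
    exact hx i

/-- The product map on `Nⁿ` modulo `[F, N]` is a homomorphism. -/
theorem mk_list_prod_ofFn_mul [N.Normal] {x y : Fin n → F} (hx : ∀ i, x i ∈ N) :
    (((List.ofFn (x * y)).prod : F) : F ⧸ ⁅(⊤ : Subgroup F), N⁆) =
      (List.ofFn x).prod * (List.ofFn y).prod := by
  induction n with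
  | zero => simp
  | succ n ih =>
    rw [List.ofFn_succ, List.ofFn_succ, List.ofFn_succ, List.prod_cons, List.prod_cons,
      List.prod_cons]
    have h := ih (x := fun i => x i.succ) (y := fun i => y i.succ) fun i => hx _
    simp only [QuotientGroup.mk_mul, Pi.mul_apply] at h ⊢
    erw [h]
    rw [mul_assoc, mul_assoc, ← mul_assoc ((y 0 : F) : F ⧸ ⁅(⊤ : Subgroup F), N⁆),
      ← mk_mul_comm_of_mem N (list_prod_ofFn_mem N fun i => hx (Fin.succ i)), mul_assoc]

/-- The product of an element of `Nⁿ` modulo `[F, N]` is invariant under conjugation. -/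
theorem mk_list_prod_ofFn_conj [N.Normal] {x y : Fin n → F} (hx : ∀ i, x i ∈ N) :
    (((List.ofFn (y * x * y⁻¹)).prod : F) : F ⧸ ⁅(⊤ : Subgroup F), N⁆) =
      (List.ofFn x).prod := by
  rw [← QuotientGroup.mk'_apply, ← QuotientGroup.mk'_apply, map_list_prod, map_list_prod,
    List.map_ofFn, List.map_ofFn]
  congr 2
  funext i
  change ((y i * x i * (y i)⁻¹ : F) : F ⧸ ⁅(⊤ : Subgroup F), N⁆) = x i
  rw [QuotientGroup.mk_mul, QuotientGroup.mk_mul, ← mk_mul_comm_of_mem N (hx i),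
    QuotientGroup.mk_inv, mul_inv_cancel_right]

theorem list_prod_ofFn_mulSingle {M : Type*} [Monoid M] (i : Fin n) (x : M) :
    (List.ofFn (Pi.mulSingle i x : Fin n → M)).prod = x := by
  induction n with
  | zero => exact i.elim0
  | succ n ih =>
    rw [List.ofFn_succ, List.prod_cons]
    refine Fin.cases ?_ (fun j => ?_) i
    · simp
    · rw [Pi.mulSingle_eq_of_ne (Fin.succ_ne_zero j).symm, one_mul]
      convert ih j using 3
      funext k
      by_cases h : k = j
      · subst h; simp
      · rw [Pi.mulSingle_eq_of_ne h, Pi.mulSingle_eq_of_ne (by simpa using h)]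

/-- The tuples described form a normal subgroup, by the homomorphism and conjugation properties of
the product, and it contains 𝒦(N, n) because [N, N] ≤ [F, N]. -/
theorem mem_of_mem_calKClosure [N.Normal] {x : Fin n → F} (hx : x ∈ calKClosure N n) :
    (∀ i, x i ∈ N) ∧ (List.ofFn x).prod ∈ ⁅(⊤ : Subgroup F), N⁆ := by
  let S : Subgroup (Fin n → F) :=
    { carrier := {x | (∀ i, x i ∈ N) ∧ (List.ofFn x).prod ∈ ⁅(⊤ : Subgroup F), N⁆}
      one_mem' := ⟨fun i => N.one_mem, by
        rw [List.prod_ofFn_one]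
        exact Subgroup.one_mem _⟩
      mul_mem' := fun {a b} ha hb => ⟨fun i => N.mul_mem (ha.1 i) (hb.1 i), by
        have h := mk_list_prod_ofFn_mul N (y := b) ha.1
        rw [(QuotientGroup.eq_one_iff _).2 ha.2, (QuotientGroup.eq_one_iff _).2 hb.2, mul_one] at h
        exact (QuotientGroup.eq_one_iff _).1 h⟩
      inv_mem' := fun {a} ha => ⟨fun i => N.inv_mem (ha.1 i), by
        have h := mk_list_prod_ofFn_mul N (y := a⁻¹) ha.1
        rw [(QuotientGroup.eq_one_iff _).2 ha.2, one_mul, mul_inv_cancel] at h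
        rw [List.prod_ofFn_one] at h
        exact (QuotientGroup.eq_one_iff _).1 h.symm⟩ }
  have hS : S.Normal := ⟨fun a ha b => ⟨fun i => ‹N.Normal›.conj_mem _ (ha.1 i) _, by
    have h := mk_list_prod_ofFn_conj N (y := b) ha.1
    rw [(QuotientGroup.eq_one_iff _).2 ha.2] at h
    exact (QuotientGroup.eq_one_iff _).1 h⟩⟩
  have h : calKClosure N n ≤ S := by
    refine Subgroup.normalClosure_le_normal ?_
    rintro _ ⟨y, hy, rfl⟩
    refine ⟨fun i => (y i).2, ?_⟩
    have hy : (List.ofFn y).prod ∈ commutator N := by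
      rw [← Abelianization.ker_of]
      exact hy
    have h1 := Subgroup.mem_map_of_mem N.subtype hy
    rw [commutator_def, Subgroup.map_commutator, ← MonoidHom.range_eq_map, Subgroup.range_subtype,
      map_list_prod, List.map_ofFn] at h1
    exact commutator_le_commutator_top_self N h1
  exact h hx

theorem prodAb_mulSingle {H : Type*} [Group H] (k : Fin n) (y : H) :
    prodAb H n (Pi.mulSingle k y) = Abelianization.of y :=
  congrArg Abelianization.of (list_prod_ofFn_mulSingle k y)

/-- The corrected tuple has trivial product in Nᵃᵇ, so it already lies in 𝒦(N, n) without any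
conjugation. -/
theorem mul_mulSingle_inv_mem_calKClosure (i : Fin n) {x : Fin n → F} (hx : ∀ k, x k ∈ N) :
    x * (Pi.mulSingle i (List.ofFn x).prod)⁻¹ ∈ calKClosure N n := by
  let y : Fin n → N := fun k => ⟨x k, hx k⟩
  have hy : N.subtype (List.ofFn y).prod = (List.ofFn x).prod := by
    rw [map_list_prod, List.map_ofFn]
    rfl
  refine Subgroup.subset_normalClosure ⟨y * (Pi.mulSingle i (List.ofFn y).prod)⁻¹, ?_, ?_⟩
  · change prodAb N n _ = 1
    rw [map_mul, map_inv, prodAb_mulSingle]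
    exact mul_inv_cancel _
  · funext k
    change N.subtype ((y * (Pi.mulSingle i (List.ofFn y).prod)⁻¹ : Fin n → N) k) = _
    rw [Pi.mul_apply, Pi.mul_apply, map_mul, Pi.inv_apply, Pi.inv_apply, map_inv,
      Pi.apply_mulSingle (fun _ => N.subtype) fun _ => map_one _, hy]
    rfl

theorem mulSingle_mul_mulSingle_inv_mem_calKClosure {i j : Fin n} {x : F}
    (hx : x ∈ N) : (Pi.mulSingle i x * Pi.mulSingle j x⁻¹ : Fin n → F) ∈ calKClosure N n := by
  refine Subgroup.subset_normalClosure
    ⟨Pi.mulSingle i ⟨x, hx⟩ * Pi.mulSingle j ⟨x, hx⟩⁻¹, ?_, ?_⟩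
  · change prodAb N n _ = 1
    rw [map_mul, prodAb_mulSingle, prodAb_mulSingle, ← map_mul, mul_inv_cancel, map_one]
  · funext k
    change N.subtype ((Pi.mulSingle i ⟨x, hx⟩ * Pi.mulSingle j ⟨x, hx⟩⁻¹ : Fin n → N) k) = _
    rw [Pi.mul_apply, Pi.mul_apply, map_mul,
      Pi.apply_mulSingle (fun _ => N.subtype) fun _ => map_one _,
      Pi.apply_mulSingle (fun _ => N.subtype) fun _ => map_one _]
    rfl

/-- Take z in coordinate i and z⁻¹ in another coordinate j. Conjugating by y in coordinate i and
dividing by the original leaves [y, z] in coordinate i alone. -/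
theorem mulSingle_mem_calKClosure [N.Normal] (hn : 2 ≤ n) (i : Fin n) {x : F}
    (hx : x ∈ ⁅(⊤ : Subgroup F), N⁆) : (Pi.mulSingle i x : Fin n → F) ∈ calKClosure N n := by
  have : Nontrivial (Fin n) := Fin.nontrivial_iff_two_le.2 hn
  obtain ⟨j, hj⟩ := exists_ne i
  have h : ⁅(⊤ : Subgroup F), N⁆ ≤
      (calKClosure N n).comap (MonoidHom.mulSingle (fun _ : Fin n => F) i) := by
    rw [Subgroup.commutator_le]
    intro y _ z hz
    have h1 := mulSingle_mul_mulSingle_inv_mem_calKClosure N (i := i) (j := j) hz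
    have h2 := (calKClosure_normal N n).conj_mem _ h1 (Pi.mulSingle i y)
    have h3 := Subgroup.mul_mem _ h2 (Subgroup.inv_mem _ h1)
    change (Pi.mulSingle i (y * z * y⁻¹ * z⁻¹) : Fin n → F) ∈ calKClosure N n
    convert h3 using 1
    funext k
    simp only [Pi.mul_apply, Pi.inv_apply]
    by_cases hki : k = i
    · subst hki
      simp [hj.symm]
    · simp [hki]
  exact h hx

end Closure

/-! ### The one-coordinate embedding into 𝒦̃(G, n) -/

section KTilde

variable {F : Type v} {G : Type u} [Group F] [Group G] (π : F →* G) {n : ℕ}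

theorem mulSingle_mem_calK (i : Fin n) {x : F} (hx : x ∈ commutator F) :
    (Pi.mulSingle i x : Fin n → F) ∈ calK F n := by
  change prodAb F n _ = 1
  rw [prodAb_mulSingle]
  rwa [← Abelianization.ker_of] at hx

theorem KTilde.mk_eq_mk_iff {x y : calK F n} :
    (QuotientGroup.mk x : KTilde π n) = QuotientGroup.mk y ↔
      (x : Fin n → F)⁻¹ * y ∈ calKClosure π.ker n := by
  rw [QuotientGroup.eq, Subgroup.mem_subgroupOf]
  rfl

/-- The homomorphism `x ↦ (1, …, x, …, 1)` from `N ∩ [F, F]` to `𝒦̃(G, n)`. -/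
def KTilde.single (i : Fin n) : ↥(π.ker ⊓ commutator F) →* KTilde π n :=
  (QuotientGroup.mk' _).comp
    (((MonoidHom.mulSingle (fun _ : Fin n => F) i).comp (Subgroup.subtype _)).codRestrict
      (calK F n) fun x => mulSingle_mem_calK i x.2.2)

theorem KTilde.single_apply (i : Fin n) (x : ↥(π.ker ⊓ commutator F)) :
    KTilde.single π i x = (QuotientGroup.mk ⟨Pi.mulSingle i (x : F), mulSingle_mem_calK i x.2.2⟩) :=
  rfl

theorem KTilde.single_eq_single (i j : Fin n) : KTilde.single π i = KTilde.single π j := by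
  ext x
  rw [KTilde.single_apply, KTilde.single_apply, KTilde.mk_eq_mk_iff]
  have h := mulSingle_mul_mulSingle_inv_mem_calKClosure π.ker (i := i) (j := j)
    (π.ker.inv_mem x.2.1)
  rw [inv_inv, Pi.mulSingle_inv] at h
  exact h

theorem KTilde.single_eq_one_iff (hn : 2 ≤ n) (i : Fin n) (x : ↥(π.ker ⊓ commutator F)) :
    KTilde.single π i x = 1 ↔ (x : F) ∈ ⁅(⊤ : Subgroup F), π.ker⁆ := by
  rw [KTilde.single_apply, QuotientGroup.eq_one_iff, Subgroup.mem_subgroupOf]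
  refine ⟨fun h => ?_, mulSingle_mem_calKClosure π.ker hn i⟩
  have h := (mem_of_mem_calKClosure π.ker h).2
  rwa [list_prod_ofFn_mulSingle] at h

/-- A commutator with a tuple supported in coordinate i is supported there too, and its entry lies
in [F, N]. -/
theorem KTilde.single_mem_center (hn : 2 ≤ n) (i : Fin n) (x : ↥(π.ker ⊓ commutator F)) :
    KTilde.single π i x ∈ Subgroup.center (KTilde π n) := by
  rw [Subgroup.mem_center_iff]
  intro y
  induction y using QuotientGroup.induction_on with | H y
  rw [KTilde.single_apply, ← QuotientGroup.mk_mul, ← QuotientGroup.mk_mul, eq_comm,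
    KTilde.mk_eq_mk_iff]
  have h := Subgroup.commutator_mem_commutator
    (Subgroup.mem_top ((y : Fin n → F) i)⁻¹) (π.ker.inv_mem x.2.1)
  rw [commutatorElement_def, inv_inv, inv_inv] at h
  have h := mulSingle_mem_calKClosure π.ker hn i h
  convert h using 1
  change (Pi.mulSingle i (x : F) * (y : Fin n → F))⁻¹ * ((y : Fin n → F) * Pi.mulSingle i (x : F)) =
    Pi.mulSingle i _
  funext k
  simp only [Pi.mul_apply, Pi.inv_apply]
  by_cases hk : k = i
  · subst hk
    simp [mul_assoc]
  · simp [hk]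

/-- A commutator in one coordinate is a commutator of elements of `𝒦(F, n)` if `n ≥ 3`. -/
theorem KTilde.single_mem_commutator (hn : 3 ≤ n) (x : ↥(π.ker ⊓ commutator F)) :
    KTilde.single π ⟨0, by omega⟩ x ∈ commutator (KTilde π n) := by
  let i₀ : Fin n := ⟨0, by omega⟩
  let i₁ : Fin n := ⟨1, by omega⟩
  let i₂ : Fin n := ⟨2, by omega⟩
  have h01 : i₀ ≠ i₁ := by simp [i₀, i₁]
  have h02 : i₀ ≠ i₂ := by simp [i₀, i₂]
  have h12 : i₁ ≠ i₂ := by simp [i₁, i₂]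
  let W : Subgroup (Fin n → F) := (commutator (calK F n)).map (calK F n).subtype
  have hW : commutator F ≤ W.comap (MonoidHom.mulSingle (fun _ : Fin n => F) i₀) := by
    rw [commutator_def, Subgroup.commutator_le]
    intro a _ b _
    have hm (i j : Fin n) (c : F) :
        (Pi.mulSingle i c * Pi.mulSingle j c⁻¹ : Fin n → F) ∈ calK F n := by
      change prodAb F n _ = 1
      rw [map_mul, prodAb_mulSingle, prodAb_mulSingle, ← map_mul, mul_inv_cancel, map_one]
    -- The supports {0, 1} and {0, 2} meet only in coordinate 0, so the commutator is [a, b] there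
    -- and trivial elsewhere. This is where three coordinates are needed.
    refine ⟨_, Subgroup.commutator_mem_commutator (Subgroup.mem_top ⟨_, hm i₀ i₁ a⟩)
      (Subgroup.mem_top ⟨_, hm i₀ i₂ b⟩), ?_⟩
    rw [map_commutatorElement, commutatorElement_def, commutatorElement_def]
    change (Pi.mulSingle i₀ a * Pi.mulSingle i₁ a⁻¹ : Fin n → F) *
      (Pi.mulSingle i₀ b * Pi.mulSingle i₂ b⁻¹ : Fin n → F) *
      (Pi.mulSingle i₀ a * Pi.mulSingle i₁ a⁻¹ : Fin n → F)⁻¹ *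
      (Pi.mulSingle i₀ b * Pi.mulSingle i₂ b⁻¹ : Fin n → F)⁻¹ =
        Pi.mulSingle i₀ (a * b * a⁻¹ * b⁻¹)
    funext k
    simp only [Pi.mul_apply, Pi.inv_apply]
    by_cases h0 : k = i₀
    · rw [h0]; simp [h01, h02]
    · by_cases h1 : k = i₁
      · rw [h1]; simp [h01.symm, h12]
      · simp [h0, h1]
  obtain ⟨y, hy, hyx⟩ := hW x.2.2
  have h1 := Subgroup.mem_map_of_mem
    (QuotientGroup.mk' ((calKClosure π.ker n).subgroupOf (calK F n))) hy
  rw [commutator_def, Subgroup.map_commutator,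
    Subgroup.map_top_of_surjective _ (QuotientGroup.mk'_surjective _)] at h1
  have : y = ⟨Pi.mulSingle i₀ (x : F), mulSingle_mem_calK i₀ x.2.2⟩ := Subtype.ext hyx
  rw [this] at h1
  exact h1

end KTilde

/-! ### The exact sequence over Gⁿ⁻¹ for abelian G -/

section Abelian

variable {F : Type v} {G : Type u} [Group F] [CommGroup G] (π : F →* G) {n : ℕ}

theorem prod_mem_ker_of_mem_calK {x : Fin n → F} (hx : x ∈ calK F n) :
    (List.ofFn x).prod ∈ π.ker ⊓ commutator F := by
  have : (List.ofFn x).prod ∈ commutator F := by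
    rw [← Abelianization.ker_of]
    exact hx
  exact ⟨Abelianization.commutator_subset_ker π this, this⟩

/-- The map `𝒦̃(G, n) → Gⁿ⁻¹` for `G` abelian. -/
abbrev KTilde.init (n : ℕ) : KTilde π n →* (Fin (n - 1) → G) :=
  (calKInit G n).comp (KTilde.proj π n)

theorem KTilde.init_mk (x : calK F n) (i : Fin (n - 1)) :
    KTilde.init π n (QuotientGroup.mk x) i = π ((x : Fin n → F) (Fin.castLE (Nat.sub_le n 1) i)) :=
  rfl

theorem KTilde.init_surjective (hn : 1 ≤ n) (hπ : Function.Surjective π) :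
    Function.Surjective (KTilde.init π n) := by
  obtain ⟨m, rfl⟩ := Nat.exists_eq_add_of_le' hn
  intro g
  choose f hf using fun i => hπ (g i)
  let f : Fin m → F := f
  have hx : (Fin.snoc f (List.ofFn f).prod⁻¹ : Fin (m + 1) → F) ∈ calK F (m + 1) := by
    rw [mem_calK, List.ofFn_succ']
    simp
  refine ⟨QuotientGroup.mk ⟨_, hx⟩, funext fun i => ?_⟩
  rw [KTilde.init_mk]
  refine Eq.trans ?_ (hf i)
  congr 1
  exact Fin.snoc_castSucc (α := fun _ => F) _ _ (i : Fin m)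

theorem KTilde.init_ker (hn : 2 ≤ n) (i : Fin n) :
    (KTilde.init π n).ker = (KTilde.single π i).range := by
  apply le_antisymm
  · intro y hy
    induction y using QuotientGroup.induction_on with | H y
    have hy' (k : Fin (n - 1)) : π ((y : Fin n → F) (Fin.castLE (Nat.sub_le n 1) k)) = 1 :=
      congrFun hy k
    have hP := prod_mem_ker_of_mem_calK π y.2
    -- The hypothesis covers only the first n - 1 coordinates; the last follows because the full
    -- product lies in [F, F] ≤ N.
    have hker (k : Fin n) : (y : Fin n → F) k ∈ π.ker := by
      obtain ⟨m, rfl⟩ := Nat.exists_eq_add_of_le' (show 1 ≤ n by omega)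
      refine Fin.lastCases ?_ (fun k => hy' k) k
      have h1 : π (List.ofFn (y : Fin (m + 1) → F)).prod = 1 := hP.1
      rw [map_list_prod, List.map_ofFn, List.prod_ofFn, Fin.prod_univ_castSucc] at h1
      rw [Finset.prod_eq_one (s := Finset.univ) (f := fun k : Fin m =>
        (π ∘ (y : Fin (m + 1) → F)) k.castSucc) fun k _ => hy' k, one_mul] at h1
      exact h1
    refine ⟨⟨_, hP⟩, ?_⟩
    rw [KTilde.single_apply, eq_comm, KTilde.mk_eq_mk_iff]
    have h := mul_mulSingle_inv_mem_calKClosure π.ker i hker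
    have h := Subgroup.inv_mem _ h
    rw [mul_inv_rev, inv_inv] at h
    exact (calKClosure_normal π.ker n).mem_comm h
  · rintro _ ⟨x, rfl⟩
    rw [KTilde.single_apply, MonoidHom.mem_ker]
    funext k
    rw [KTilde.init_mk]
    change π ((Pi.mulSingle i (x : F) : Fin n → F) _) = 1
    rw [Pi.apply_mulSingle (fun _ => π) fun _ => map_one π, show π x = 1 from x.2.1,
      Pi.mulSingle_one]
    rfl

end Abelian

/-! ### Frattini subgroups of central extensions and powers -/

section Frattini

theorem mem_frattini_iff {G : Type*} [Group G] {x : G} :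
    x ∈ frattini G ↔ ∀ M : Subgroup G, IsCoatom M → x ∈ M := by
  simp [frattini, Order.radical, Subgroup.mem_iInf]

/-- If `[G, G]` is central then it lies in the Frattini subgroup. -/
theorem commutator_le_frattini_of_le_center {G : Type*} [Group G]
    (h : commutator G ≤ Subgroup.center G) : commutator G ≤ frattini G := by
  refine le_iInf₂ fun M hM => ?_
  -- Otherwise M [G, G] = G, and every commutator in G equals one of elements of M, since the
  -- central factors cancel.
  by_contra hc
  have htop : M ⊔ commutator G = ⊤ := hM.2 _ (left_lt_sup.2 hc)
  refine hc ?_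
  rw [commutator_def, Subgroup.commutator_le]
  have hmem (g : G) : ∃ m ∈ M, ∃ z ∈ commutator G, m * z = g :=
    Subgroup.mem_sup_of_normal_right.1 (htop ▸ Subgroup.mem_top g)
  intro a _ b _
  obtain ⟨m, hm, z, hz, rfl⟩ := hmem a
  obtain ⟨m', hm', z', hz', rfl⟩ := hmem b
  have hz := Subgroup.mem_center_iff.1 (h hz)
  have hz' := Subgroup.mem_center_iff.1 (h hz')
  have : m * z * (m' * z') * (m * z)⁻¹ * (m' * z')⁻¹ = m * m' * m⁻¹ * m'⁻¹ := by
    rw [mul_inv_rev, mul_inv_rev, mul_assoc m z, ← hz, ← mul_assoc m _ z, mul_assoc (m * _) z,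
      mul_inv_cancel_left, ← mul_assoc m m', mul_assoc (m * m') z', ← hz' m⁻¹,
      ← mul_assoc (m * m') _ z', mul_assoc _ z', mul_inv_cancel_left]
  rw [commutatorElement_def, this]
  exact M.mul_mem (M.mul_mem (M.mul_mem hm hm') (M.inv_mem hm)) (M.inv_mem hm')

/-- Every maximal subgroup of G contains ker f, so it is the preimage of a maximal subgroup of H. -/
theorem frattini_eq_comap_of_ker_le {G H : Type*} [Group G] [Group H] {f : G →* H}
    (hf : Function.Surjective f) (hk : f.ker ≤ frattini G) :
    frattini G = (frattini H).comap f := by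
  refine le_antisymm (frattini_le_comap_frattini_of_surjective hf) fun x hx => ?_
  have hx : f x ∈ frattini H := hx
  refine mem_frattini_iff.2 fun M hM => ?_
  have hkM : f.ker ≤ M := hk.trans (frattini_le_coatom hM)
  have hcm : (M.map f).comap f = M := by
    rw [Subgroup.comap_map_eq, sup_eq_left.2 hkM]
  have hco : IsCoatom (M.map f) := by
    refine ⟨fun h => hM.1 ?_, fun K hK => ?_⟩
    · rw [← hcm, h, Subgroup.comap_top]
    · have : M < K.comap f := by
        rw [← hcm]
        exact (Subgroup.comap_lt_comap_of_surjective hf).2 hK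
      rw [← Subgroup.map_comap_eq_self_of_surjective hf K, hM.2 _ this,
        Subgroup.map_top_of_surjective _ hf]
  rw [← hcm]
  exact frattini_le_coatom hco hx

/-- The preimage of a maximal subgroup under a coordinate inclusion is either everything or maximal,
so it contains the Frattini subgroup of A. No finiteness of A is involved. -/
theorem mem_frattini_pi {ι A : Type*} [Finite ι] [CommGroup A] {x : ι → A} :
    x ∈ frattini (ι → A) ↔ ∀ i, x i ∈ frattini A := by
  classical
  refine ⟨fun hx i => frattini_le_comap_frattini_of_surjective
    (φ := Pi.evalMonoidHom (fun _ : ι => A) i) (Function.surjective_eval i) hx, fun hx => ?_⟩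
  refine mem_frattini_iff.2 fun M hM => ?_
  have := Fintype.ofFinite ι
  rw [← Finset.univ_prod_mulSingle x]
  refine Subgroup.prod_mem _ fun i _ => ?_
  let f := MonoidHom.mulSingle (fun _ : ι => A) i
  suffices h : M.comap f = ⊤ ∨ IsCoatom (M.comap f) by
    have : x i ∈ M.comap f := by
      rcases h with h | h
      · rw [h]; exact Subgroup.mem_top _
      · exact frattini_le_coatom h (hx i)
    exact this
  refine or_iff_not_imp_left.2 fun hne => ⟨hne, fun K hK => ?_⟩
  have htop : M ⊔ K.map f = ⊤ := by
    refine hM.2 _ (left_lt_sup.2 fun h => ?_)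
    exact hK.not_ge (Subgroup.map_le_iff_le_comap.1 h)
  refine (Subgroup.eq_top_iff' _).2 fun a => ?_
  obtain ⟨m, hm, _, ⟨k, hk, rfl⟩, hmk⟩ := Subgroup.mem_sup.1 (htop ▸ Subgroup.mem_top (f a))
  have : a * k⁻¹ ∈ M.comap f := by
    rw [Subgroup.mem_comap, map_mul, map_inv, ← hmk, mul_inv_cancel_right]
    exact hm
  simpa using K.mul_mem (hK.le this) hk

end Frattini

/-! ### Nontriviality of H₂ for noncyclic finite abelian p-groups -/

section Noncyclic

/-- G is a product of nontrivial cyclic groups of p-power order, with at least two factors as it is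
not cyclic. Project to two of them and reduce modulo p; a and b are generators of these factors. -/
theorem exists_two_homs_of_not_isCyclic {p : ℕ} [Fact p.Prime] {G : Type*} [CommGroup G] [Finite G]
    (hG : IsPGroup p G) (hc : ¬ IsCyclic G) :
    ∃ (α β : G →* Multiplicative (ZMod p)) (a b : G), (α a).toAdd = 1 ∧ (β b).toAdd = 1 ∧
      (α b).toAdd = 0 ∧ (β a).toAdd = 0 := by
  classical
  obtain ⟨ι, _, n, hn, ⟨e⟩⟩ := CommGroup.equiv_prod_multiplicative_zmod_of_finite G
  have hdvd (i : ι) : p ∣ n i := by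
    have hs : Function.Surjective
        ((Pi.evalMonoidHom (fun i => Multiplicative (ZMod (n i))) i).comp e.toMonoidHom) :=
      (Function.surjective_eval i).comp e.surjective
    have : NeZero (n i) := ⟨by have := hn i; omega⟩
    obtain ⟨k, hk⟩ := IsPGroup.iff_card.1 (hG.of_surjective _ hs)
    rw [Nat.card_eq_fintype_card, Fintype.card_multiplicative, ZMod.card] at hk
    rw [hk]
    refine dvd_pow_self p fun h => ?_
    have := hn i
    rw [hk, h, pow_zero] at this
    exact this.false
  have hnt : Nontrivial ι := by
    by_contra h
    rw [not_nontrivial_iff_subsingleton] at h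
    refine hc ?_
    rcases isEmpty_or_nonempty ι with hι | ⟨⟨i⟩⟩
    · have := e.injective.subsingleton
      infer_instance
    · refine isCyclic_of_injective
        ((Pi.evalMonoidHom (fun i => Multiplicative (ZMod (n i))) i).comp e.toMonoidHom)
        fun x y hxy => e.injective (funext fun k => ?_)
      rw [Subsingleton.elim k i]
      exact hxy
  obtain ⟨i, j, hij⟩ := exists_pair_ne ι
  let γ (i : ι) : G →* Multiplicative (ZMod p) :=
    ((AddMonoidHom.toMultiplicative (ZMod.castHom (hdvd i) (ZMod p)).toAddMonoidHom).comp
      (Pi.evalMonoidHom (fun i => Multiplicative (ZMod (n i))) i)).comp e.toMonoidHom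
  let δ (i : ι) : G := e.symm (Pi.mulSingle i (Multiplicative.ofAdd 1))
  have h (i j : ι) : γ i (δ j) = Multiplicative.ofAdd (ZMod.castHom (hdvd i) (ZMod p)
      (Pi.mulSingle (M := fun i => Multiplicative (ZMod (n i))) j
        (Multiplicative.ofAdd 1) i).toAdd) := by
    change Multiplicative.ofAdd (ZMod.castHom (hdvd i) (ZMod p) (e (e.symm _) i).toAdd) = _
    rw [e.apply_symm_apply]
  refine ⟨γ i, γ j, δ i, δ j, ?_, ?_, ?_, ?_⟩
  · rw [h, Pi.mulSingle_eq_same]; exact map_one (ZMod.castHom (hdvd i) (ZMod p))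
  · rw [h, Pi.mulSingle_eq_same]; exact map_one (ZMod.castHom (hdvd j) (ZMod p))
  · rw [h, Pi.mulSingle_eq_of_ne hij]; simp
  · rw [h, Pi.mulSingle_eq_of_ne hij.symm]; simp

/-- The bilinear cocycle α(g)β(h) kills boundaries but takes the value 1 on (a, b) - (b, a), which
is a cycle because a and b commute. -/
theorem HTwo.nontrivial_of_not_isCyclic {p : ℕ} [Fact p.Prime] {G : Type u} [CommGroup G] [Finite G]
    (hG : IsPGroup p G) (hc : ¬ IsCyclic G) : Nontrivial (HTwo G) := by
  obtain ⟨α, β, a, b, h1, h2, h3, h4⟩ := exists_two_homs_of_not_isCyclic hG hc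
  let τ (g h : G) : ZMod p := (α g).toAdd * (β h).toAdd
  have hτ : IsTrivialCocycle τ := by
    intro g h k
    simp only [τ, map_mul, toAdd_mul]
    ring
  let x : G × G →₀ ULift.{u} ℤ := Finsupp.single (a, b) 1 - Finsupp.single (b, a) 1
  have hd (g h : G) : (d₂₁ (trivialInt G)).hom (Finsupp.single (g, h) (1 : ULift ℤ)) =
      Finsupp.single h (1 : ULift ℤ) - Finsupp.single (g * h) 1 + Finsupp.single g 1 :=
    d₂₁_single (A := trivialInt G) (g, h) (1 : ULift ℤ)
  have hx : x ∈ cycles₂ (trivialInt G) := by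
    change (d₂₁ (trivialInt G)).hom (Finsupp.single (a, b) 1 - Finsupp.single (b, a) 1) = 0
    rw [map_sub, hd, hd, mul_comm b a]
    abel
  refine ⟨Multiplicative.ofAdd ((H2π (trivialInt G)).hom ⟨x, hx⟩), 1, fun h => ?_⟩
  have h5 := linearCombination_eq_zero_of_mem_boundaries₂ hτ
    ((H2π_eq_zero_iff (A := trivialInt G) ⟨x, hx⟩).1 h)
  change Finsupp.linearCombination _ _ (Finsupp.single (a, b) 1 - Finsupp.single (b, a) 1) = _ at h5
  rw [map_sub, Finsupp.linearCombination_single, Finsupp.linearCombination_single] at h5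
  simp [τ, h1, h2, h3, h4] at h5

end Noncyclic

/-! ### The Hopf map into 𝒦̃(G, n) and the final result -/

section Assembly

variable {F : Type v} {G : Type u} [Group F] [CommGroup G] (π : F →* G) {n : ℕ}

/-- The injection of the second homology given by Hopf's formula. -/
theorem exists_isHopfMap [IsFreeGroup F] (hπ : Function.Surjective π) (hn : 2 ≤ n) :
    ∃ ι : HTwo G →* KTilde π n, IsHopfMap π n ι ∧ Function.Injective ι ∧
      ι.range = (KTilde.single π (⟨0, by omega⟩ : Fin n)).range := by
  obtain ⟨u, hu, hur, hus⟩ := exists_hopf π hπ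
  let i₀ : Fin n := ⟨0, by omega⟩
  -- q has the same range as u and the same kernel as the one-coordinate map, so ι can be defined by
  -- lifting u through q.
  let q := (QuotientGroup.mk' ⁅(⊤ : Subgroup F), π.ker⁆).comp (π.ker ⊓ commutator F).subtype
  have hqr : q.range = u.range := by
    rw [hur, MonoidHom.range_comp, Subgroup.range_subtype]
  have hqk (x) : q x = 1 ↔ (x : F) ∈ ⁅(⊤ : Subgroup F), π.ker⁆ := QuotientGroup.eq_one_iff _
  have hker : q.ker = (KTilde.single π i₀).ker := by
    ext x
    rw [MonoidHom.mem_ker, MonoidHom.mem_ker, hqk, KTilde.single_eq_one_iff π hn]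
  obtain ⟨ι, hι⟩ := exists_monoidHom_of_range_le_of_ker_le u q (KTilde.single π i₀)
    hqr.ge hker.le
  have hqx (z : HTwo G) : ∃ x, q x = u z := by
    have : u z ∈ q.range := hqr ▸ ⟨z, rfl⟩
    exact this
  refine ⟨ι, ?_, ?_, ?_⟩
  · intro s hs L c hc i
    have h1 := hus s hs L c hc
    obtain ⟨x, hx⟩ := hqx (Multiplicative.ofAdd ((H2π (trivialInt G)).hom c))
    rw [h1] at hx
    -- The Hopf product agrees with x modulo [F, N], which is contained in N ∩ [F, F], so it lies in
    -- N ∩ [F, F] itself.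
    have h2 : (x : F)⁻¹ * (L.map fun t => (s t.1.1 * s t.1.2 * (s (t.1.1 * t.1.2))⁻¹) ^ t.2).prod
        ∈ π.ker ⊓ commutator F :=
      le_inf (Subgroup.commutator_le_right _ _) (Subgroup.commutator_mono le_rfl le_top)
        (QuotientGroup.eq.1 hx)
    rw [Subgroup.mul_mem_cancel_left _ (inv_mem x.2)] at h2
    refine ⟨⟨_, mulSingle_mem_calK i h2.2⟩, rfl, ?_⟩
    rw [hι _ ⟨_, h2⟩ h1.symm, KTilde.single_eq_single π i₀ i]
    rfl
  · rw [injective_iff_map_eq_one]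
    intro z hz
    obtain ⟨x, hx⟩ := hqx z
    rw [hι z x hx] at hz
    have : q x = 1 := hker.ge hz
    rw [this] at hx
    exact hu (hx.symm.trans (map_one u).symm)
  · apply le_antisymm
    · rintro _ ⟨z, rfl⟩
      obtain ⟨x, hx⟩ := hqx z
      exact ⟨x, (hι z x hx).symm⟩
    · rintro _ ⟨x, rfl⟩
      obtain ⟨z, hz⟩ : q x ∈ u.range := hqr ▸ ⟨x, rfl⟩
      exact ⟨z, hι z x hz.symm⟩

end Assembly

theorem proposition4p6 {p : ℕ} [Fact p.Prime] {G : Type u} [CommGroup G] (hG : IsPGroup p G)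
    {n : ℕ} (hn : 3 ≤ n) {F : Type v} [Group F] [IsFreeGroup F]
    (π : F →* G) (hπ : Function.Surjective π) :
    ∃ E : GroupExtension (HTwo G) (KTilde π n) (Fin (n - 1) → G),
      E.rightHom = (calKInit G n).comp (KTilde.proj π n) ∧ IsHopfMap π n E.inl ∧
      (Finite G → ¬ IsCyclic G →
        Group.IsNilpotent (KTilde π n) ∧ Group.nilpotencyClass (KTilde π n) = 2) ∧
      commutator (KTilde π n) = E.inl.range ∧
      ∃ E' : GroupExtension (HTwo G) (frattini (KTilde π n)) (Fin (n - 1) → frattini G),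
        (∀ x, (E'.inl x : KTilde π n) = E.inl x) ∧
        ∀ y i, (E'.rightHom y i : G) = E.rightHom y i := by
  obtain ⟨ι, hH, hinj, hr⟩ := exists_isHopfMap π hπ (n := n) (by omega)
  have hker : ι.range = (KTilde.init π n).ker := by
    rw [hr, KTilde.init_ker π (by omega)]
  have hsurj := KTilde.init_surjective π (n := n) (by omega) hπ
  have hcomm : commutator (KTilde π n) = ι.range := by
    apply le_antisymm
    · rw [hker]
      exact Abelianization.commutator_subset_ker _
    · rw [hr]
      rintro _ ⟨x, rfl⟩
      exact KTilde.single_mem_commutator π hn x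
  have hcenter : (KTilde.init π n).ker ≤ Subgroup.center (KTilde π n) := by
    rw [← hker, hr]
    rintro _ ⟨x, rfl⟩
    exact KTilde.single_mem_center π (by omega) _ x
  have hfr : (KTilde.init π n).ker ≤ frattini (KTilde π n) := by
    rw [← hker, ← hcomm]
    rw [← hker, ← hcomm] at hcenter
    exact commutator_le_frattini_of_le_center hcenter
  have hcomap := frattini_eq_comap_of_ker_le hsurj hfr
  have hmem (y : KTilde π n) : y ∈ frattini (KTilde π n) ↔
      ∀ i, KTilde.init π n y i ∈ frattini G := by
    rw [← mem_frattini_pi, hcomap]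
    rfl
  have hιmem (z : HTwo G) : ι z ∈ frattini (KTilde π n) := hfr (hker ▸ ⟨z, rfl⟩)
  let ρ' : frattini (KTilde π n) →* (Fin (n - 1) → frattini G) :=
    { toFun y i := ⟨KTilde.init π n y i, (hmem y).1 y.2 i⟩
      map_one' := by
        funext i
        exact Subtype.ext (congrFun (map_one (KTilde.init π n)) i)
      map_mul' x y := by
        funext i
        exact Subtype.ext (congrFun (map_mul (KTilde.init π n) (x : KTilde π n) y) i) }
  refine ⟨⟨ι, KTilde.init π n, hinj, hker, hsurj⟩, rfl, hH, fun _ hcyc => ?_, hcomm,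
    ⟨ι.codRestrict _ hιmem, ρ', ?_, ?_, ?_⟩, fun _ => rfl, fun _ _ => rfl⟩
  · have hnil : Group.IsNilpotent (KTilde π n) := Subgroup.isNilpotent_of_ker_le_center _ hcenter
    refine ⟨hnil, le_antisymm ((Group.nilpotencyClass_le_of_ker_le_center _ hcenter).trans
      (Nat.succ_le_succ CommGroup.nilpotencyClass_le_one)) ?_⟩
    -- Class at most 1 would make the commutator subgroup, and with it H₂, trivial.
    by_contra hlt
    have := Group.IsNilpotent.nilpotencyClass_le_one_iff.1 (Nat.lt_succ_iff.1 (not_le.1 hlt))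
    have hbot : commutator (KTilde π n) = ⊥ := by
      rw [commutator_def, eq_bot_iff, Subgroup.commutator_le]
      intro a _ b _
      exact commutatorElement_eq_one_iff_mul_comm.2 (this.is_comm.comm a b)
    have := HTwo.nontrivial_of_not_isCyclic hG hcyc
    obtain ⟨z, hz⟩ := exists_ne (1 : HTwo G)
    refine hz (hinj ?_)
    rw [map_one, ← Subgroup.mem_bot, ← hbot, hcomm]
    exact ⟨z, rfl⟩
  · exact fun x y h => hinj (congrArg Subtype.val h)
  · ext y
    have h1 : (y : KTilde π n) ∈ ι.range ↔ KTilde.init π n y = 1 := by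
      rw [hker, MonoidHom.mem_ker]
    constructor
    · rintro ⟨z, rfl⟩
      funext i
      exact Subtype.ext (congrFun (h1.1 ⟨z, rfl⟩) i)
    · intro hy
      obtain ⟨z, hz⟩ := h1.2 (funext fun i => congrArg Subtype.val (congrFun hy i))
      exact ⟨z, Subtype.ext hz⟩
  · intro g
    obtain ⟨y, hy⟩ := hsurj fun i => g i
    refine ⟨⟨y, (hmem y).2 fun i => ?_⟩, funext fun i => Subtype.ext (congrFun hy i)⟩
    rw [hy]
    exact (g i).2
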